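/- **Theorem.** Let $\Gamma$ be a finite normal-form game with a finite set $V$ of players, finite nonempty pure action sets $S_k$ and payoff functions $u_k:\prod_{l\in V}S_l\to\mathbb R$ ($k\in V$). Let $\Delta_k$ be the simplex of probability vectors on $S_k$, let $\Delta=\prod_{k\in V}\Delta_k$, and let $r_{ki}(\mathbf x_{-k})$ be the expected payoff of player $k$ for the pure action $i\in S_k$ when the other players randomize independently according to $\mathbf x_{-k}=(\mathbf x_l)_{l\neq k}$ (extended multilinearly to real vectors). Let $r_k=(r_{ki})_{i\in S_k}$, and let $\ln$ act coordinatewise on vectors. Let $T_k>0$, $k\in V$, be exploration rates, and consider the Q-learning dynamics on $\Delta$, $$\dot x_{ki}=x_{ki}\left[r_{ki}(\mathbf x_{-k})-\mathbf x_k^\top r_k(\mathbf x_{-k})-T_k\left(\ln x_{ki}-\mathbf x_k^\top\ln \mathbf x_k\right)\right],\qquad i\in S_k,\ k\in V .$$ A point of $\Delta$ is called interior if all its coordinates are positive. A (logit) Quantal Response Equilibrium (QRE) of $\Gamma$ with rates $(T_k)$ is a profile $\mathbf p\in\Delta$ in which every $\mathbf p_k$ is the logit response $\left(e^{v_i/T_k}/\sum_{j\in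 S_k}e^{v_j/T_k}\right)_{i\in S_k}$ to the reward vector $v=r_k(\mathbf p_{-k})$. Then: 1. The interior fixed points of the Q-learning dynamics are exactly the families $\mathbf p=(\mathbf p_k)_{k\in V}$ of real vectors $\mathbf p_k\in\mathbb R^{S_k}$ that solve the system $$p_{ki}=\frac{\exp\left(r_{ki}(\mathbf p_{-k})/T_k\right)}{\sum_{j\in S_k}\exp\left(r_{kj}(\mathbf p_{-k})/T_k\right)}\qquad\text{for all } i\in S_k,\ k\in V .$$ 2. The interior fixed points coincide with the Quantal Response Equilibria of $\Gamma$. 3. At least one interior fixed point exists. 4. For every interior fixed point $\mathbf p$, every $k\in V$ and every $\mathbf x_k\in\Delta_k$, $$(\mathbf x_k-\mathbf p_k)^\top\left[r_k(\mathbf p_{-k})-T_k\ln \mathbf p_k\right]=0 .$$ -/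

import Mathlib

noncomputable section

/-- A finite normal-form game with player set `V` and pure action sets `S k`, `k : V`:
every player has a real payoff for every pure action profile. -/
structure FiniteGame (V : Type*) (S : V → Type*) where
  payoff : V → (∀ k, S k) → ℝ

namespace FiniteGame

variable {V : Type*} [Fintype V] [DecidableEq V] {S : V → Type*}
  [∀ k, Fintype (S k)] [∀ k, DecidableEq (S k)]

/-- The set `Δ = ∏ k, Δ_k` of mixed strategy profiles. -/
def mixedProfiles (V : Type*) (S : V → Type*) [∀ k, Fintype (S k)] : Set (∀ k, S k → ℝ) :=
  {x | ∀ k, x k ∈ stdSimplex ℝ (S k)}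

/-- The multilinear extension of the payoff of player `k`; at `x ∈ Δ` it is the expected payoff
when the players randomize independently according to `x`. -/
def expectedPayoff (Γ : FiniteGame V S) (k : V) (x : ∀ k, S k → ℝ) : ℝ :=
  ∑ s : ∀ k, S k, (∏ j, x j (s j)) * Γ.payoff k s

/-- The reward `r_{ki}(x_{-k})`: the expected payoff of player `k` for the pure action `i` when the
others play `x_{-k}`. The component `x k` is overwritten, so the value does not depend on it. -/
def reward (Γ : FiniteGame V S) (x : ∀ k, S k → ℝ) (k : V) (i : S k) : ℝ :=
  Γ.expectedPayoff k (Function.update x k (Pi.single i 1))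

/-- The right-hand side of the Q-learning dynamics with exploration rates `T`,
`x_{ki} [r_{ki}(x_{-k}) - x_kᵀ r_k(x_{-k}) - T_k (ln x_{ki} - x_kᵀ ln x_k)]`. -/
def qLearningField (Γ : FiniteGame V S) (T : V → ℝ) (x : ∀ k, S k → ℝ) (k : V) (i : S k) : ℝ :=
  x k i * (Γ.reward x k i - ∑ j, x k j * Γ.reward x k j
    - T k * (Real.log (x k i) - ∑ j, x k j * Real.log (x k j)))

/-- Interior fixed points of the Q-learning dynamics: mixed strategy profiles with all
probabilities positive at which the vector field vanishes. -/
def IsInteriorFixedPoint (Γ : FiniteGame V S) (T : V → ℝ) (p : ∀ k, S k → ℝ) : Prop :=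
  p ∈ mixedProfiles V S ∧ (∀ k i, 0 < p k i) ∧ ∀ k i, Γ.qLearningField T p k i = 0

/-- The logit quantal response to the payoff vector `v` at exploration rate `t`. -/
def logitResponse {A : Type*} [Fintype A] (t : ℝ) (v : A → ℝ) : A → ℝ :=
  fun i => Real.exp (v i / t) / ∑ j, Real.exp (v j / t)

/-- The (logit) Quantal Response Equilibria of the game: mixed strategy profiles in which every
player plays the logit quantal response to the strategies of the others. -/
def IsQRE (Γ : FiniteGame V S) (T : V → ℝ) (p : ∀ k, S k → ℝ) : Prop :=
  p ∈ mixedProfiles V S ∧ ∀ k, p k = logitResponse (T k) (Γ.reward p k)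

end FiniteGame

end

/-!
A positive profile `p` is a rest point of the Q-learning dynamics exactly if, for every player `k`,
the quantity `r_{ki}(p) - T_k log p_{ki}` agrees for all actions `i` with its mean, that is, does not
depend on `i` (`FiniteGame.forall_qLearningField_eq_zero_iff`). Exponentiating and normalizing, this
says that `p_k` is the logit response to `r_k(p)` (`FiniteGame.eq_logitResponse_iff`); conversely the
logit system forces positivity and total mass one, so interior rest points, solutions of the logit
system and quantal response equilibria coincide. The orthogonality relation holds because
`x_k - p_k` has coordinate sum zero and is paired with a constant vector.

Existence is Brouwer's theorem for the joint logit map. The product of the players' simplices is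
embedded, after division by the number of players, in the one standard simplex on `Σ k, S k`; as the
logit map is defined for all real vectors, it becomes a self-map of that simplex
(`FiniteGame.exists_eq_logitResponse`).

Brouwer's theorem for the simplex (`exists_fixedPoint_of_mapsTo_stdSimplex`) is derived from Scarf's
lemma (`exists_isDominant_image_eq_univ`), which replaces triangulations by dominant sets for a
family of linear orders. Its proof is Sperner's parity argument: rooms are the dominant sets of full
size, doors their subsets that carry all colours but one. An interior door opens to exactly two rooms
(`IsDominant.card_extensions`), the boundary door to one (`ncard_extensions_slack`), and a room that
lacks a colour has an even number of doors (`even_card_filter_image_erase`). Applied to the lattice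
points of the simplex, ordered by their coordinates and coloured by a coordinate that the map does
not decrease, the lemma gives points at which no coordinate decreases by more than `ε`. By
compactness the total decrease attains its infimum, which is therefore zero, and at that point all
coordinates are preserved since their sum is.
-/

/-! ### Dominant sets for a family of linear orders -/

section Scarf

variable {X I α : Type*} [LinearOrder α]

/-- A finite set `R` is dominant for the linear orders on `X` that are given by the injective keys
`e i : X → α`, `i : I`, if no element of `X` lies strictly above the `e i`-minimum of `R` for all
`i` at once. -/
def IsDominant (e : I → X → α) (R : Finset X) : Prop :=
  ∀ y, ∃ i, ∀ x ∈ R, e i y ≤ e i x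

lemma IsDominant.mono {e : I → X → α} {R R' : Finset X} (h : IsDominant e R) (hR : R' ⊆ R) :
    IsDominant e R' := fun y => (h y).imp fun _ hi x hx => hi x (hR hx)

/-- The elements by which an extension of `τ` may be minimal for the order `i`: those strictly above
the minimum of `τ` for every other order. -/
def pivotSet (e : I → X → α) (τ : Finset X) (i : I) : Set X :=
  {y | ∀ k, k ≠ i → ∃ z ∈ τ, e k z < e k y}

variable [DecidableEq X]

/-- If the minima of `τ` for the orders other than `i` exhaust `τ`, adding the `i`-largest
element of the pivot set keeps `τ` dominant. -/
lemma IsDominant.insert_of_pivot {e : I → X → α} {τ : Finset X} (hτ : IsDominant e τ)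
    {i : I} (hcover : ∀ z ∈ τ, ∃ k, k ≠ i ∧ ∀ w ∈ τ, e k z ≤ e k w) {x : X}
    (hx : x ∈ pivotSet e τ i) (hmax : ∀ y ∈ pivotSet e τ i, e i y ≤ e i x) :
    x ∉ τ ∧ IsDominant e (insert x τ) := by
  constructor
  · intro hxτ
    obtain ⟨k, hk, hmin⟩ := hcover x hxτ
    obtain ⟨z, hz, hlt⟩ := hx k hk
    exact absurd (hmin z hz) (not_le.2 hlt)
  · intro y
    by_cases hy : y ∈ pivotSet e τ i
    · obtain ⟨k, hk⟩ := hτ y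
      have hki : k = i := by
        by_contra hne
        obtain ⟨z, hz, hlt⟩ := hy k hne
        exact absurd (hk z hz) (not_le.2 hlt)
      subst hki
      refine ⟨k, fun w hw => ?_⟩
      rcases Finset.mem_insert.1 hw with rfl | hw
      · exact hmax y hy
      · exact hk w hw
    · simp only [pivotSet, Set.mem_ofPred_eq, not_forall, not_exists, not_and, not_lt] at hy
      obtain ⟨k, hk, hmin⟩ := hy
      refine ⟨k, fun w hw => ?_⟩
      rcases Finset.mem_insert.1 hw with rfl | hw
      · obtain ⟨z, hz, hlt⟩ := hx k hk
        exact (hmin z hz).trans hlt.le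
      · exact hmin w hw

variable [Fintype X] [Fintype I]

/-- **Pivot step.** A nonempty dominant set with one element fewer than there are orders has
exactly two dominant one-point extensions, provided that all its pivot sets are nonempty: exactly
two of the orders have the same minimum on `τ`, and each of the two gives one extension. -/
lemma IsDominant.card_extensions {e : I → X → α} (he : ∀ i, Function.Injective (e i))
    {τ : Finset X} (hτ : IsDominant e τ) (hne : τ.Nonempty)
    (hcard : τ.card + 1 = Fintype.card I) (hpiv : ∀ i, (pivotSet e τ i).Nonempty) :
    {x | x ∉ τ ∧ IsDominant e (insert x τ)}.ncard = 2 := by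
  classical
  choose μ hμτ hμ using fun k => τ.exists_min_image (e k) hne
  have hμ_eq : ∀ k, ∀ z ∈ τ, (∀ w ∈ τ, e k z ≤ e k w) → μ k = z := fun k z hz h =>
    he k (le_antisymm (hμ k z hz) (h _ (hμτ k)))
  have hsurj : ∀ z ∈ τ, ∃ k, μ k = z := fun z hz => by
    obtain ⟨k, hk⟩ := hτ z
    exact ⟨k, hμ_eq k z hz hk⟩
  obtain ⟨i, j, hij, hμij⟩ : ∃ i j, i ≠ j ∧ μ i = μ j := by
    obtain ⟨i, -, j, -, hij, h⟩ := Finset.exists_ne_map_eq_of_card_lt_of_maps_to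
      (s := Finset.univ) (t := τ) (f := μ) (by rw [Finset.card_univ]; omega)
      (fun k _ => hμτ k)
    exact ⟨i, j, hij, h⟩
  have hcov : ∀ k, (k = i ∨ k = j) → ∀ z ∈ τ, ∃ l, l ≠ k ∧ μ l = z := by
    intro k hk z hz
    obtain ⟨l, rfl⟩ := hsurj z hz
    by_cases hl : l = k
    · subst hl
      rcases hk with rfl | rfl
      · exact ⟨j, hij.symm, hμij.symm⟩
      · exact ⟨i, hij, hμij⟩
    · exact ⟨l, hl, rfl⟩
  have hcover : ∀ k, (k = i ∨ k = j) → ∀ z ∈ τ, ∃ l, l ≠ k ∧ ∀ w ∈ τ, e l z ≤ e l w := by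
    intro k hk z hz
    obtain ⟨l, hl, rfl⟩ := hcov k hk z hz
    exact ⟨l, hl, hμ l⟩
  have hmaxex : ∀ k, ∃ x ∈ pivotSet e τ k, ∀ y ∈ pivotSet e τ k, e k y ≤ e k x := fun k =>
    Set.exists_max_image _ _ (Set.toFinite _) (hpiv k)
  choose ξ hξ hξmax using hmaxex
  have hξne : ξ i ≠ ξ j := by
    intro h
    obtain ⟨k, hk⟩ := hτ (ξ i)
    have : ∃ z ∈ τ, e k z < e k (ξ i) := by
      by_cases hki : k = i
      · rw [h]
        exact hξ j k (by rw [hki]; exact hij)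
      · exact hξ i k hki
    obtain ⟨z, hz, hlt⟩ := this
    exact absurd (hk z hz) (not_le.2 hlt)
  have hset : {x | x ∉ τ ∧ IsDominant e (insert x τ)} = {ξ i, ξ j} := by
    ext x
    simp only [Set.mem_ofPred_eq, Set.mem_insert_iff, Set.mem_singleton_iff]
    constructor
    · rintro ⟨hxτ, hdom⟩
      obtain ⟨k, hk⟩ := hdom x
      have hrest : ∀ z ∈ τ, ∃ l, l ≠ k ∧ μ l = z ∧ e l z < e l x := by
        intro z hz
        obtain ⟨l, hl⟩ := hdom z
        have hzx : e l z < e l x := lt_of_le_of_ne (hl x (Finset.mem_insert_self _ _))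
          fun h => hxτ (he l h ▸ hz)
        refine ⟨l, ?_, hμ_eq l z hz fun w hw => hl w (Finset.mem_insert_of_mem hw), hzx⟩
        rintro rfl
        exact absurd (hk z (Finset.mem_insert_of_mem hz)) (not_le.2 hzx)
      -- The orders other than `k` are as many as the points of `τ`, so their minima are distinct.
      have hinj : Set.InjOn μ ((Finset.univ.erase k : Finset I) : Set I) := by
        refine Finset.injOn_of_surjOn_of_card_le (t := τ) μ (fun l _ => hμτ l) ?_ ?_
        · intro z hz
          obtain ⟨l, hl, h, -⟩ := hrest z hz
          exact ⟨l, by simpa using hl, h⟩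
        · rw [Finset.card_erase_of_mem (Finset.mem_univ _), Finset.card_univ]; omega
      have hkij : k = i ∨ k = j := by
        by_contra! h
        exact hij (hinj (by simpa using h.1.symm) (by simpa using h.2.symm) hμij)
      have hxk : x ∈ pivotSet e τ k := by
        intro l hl
        obtain ⟨l', hl', hμl, hlt⟩ := hrest (μ l) (hμτ l)
        obtain rfl := hinj (by simpa using hl') (by simpa using hl) hμl
        exact ⟨_, hμτ _, hlt⟩
      have hxmax : ∀ y ∈ pivotSet e τ k, e k y ≤ e k x := by
        intro y hy
        obtain ⟨l, hl⟩ := hdom y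
        by_cases hlk : l = k
        · subst hlk
          exact hl x (Finset.mem_insert_self _ _)
        · obtain ⟨z, hz, hlt⟩ := hy l hlk
          exact absurd (hl z (Finset.mem_insert_of_mem hz)) (not_le.2 hlt)
      have hxeq : x = ξ k := he k (le_antisymm (hξmax k x hxk) (hxmax _ (hξ k)))
      rcases hkij with rfl | rfl
      · exact Or.inl hxeq
      · exact Or.inr hxeq
    · rintro (rfl | rfl)
      · exact hτ.insert_of_pivot (hcover i (Or.inl rfl)) (hξ i) (hξmax i)
      · exact hτ.insert_of_pivot (hcover j (Or.inr rfl)) (hξ j) (hξmax j)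
  rw [hset, Set.ncard_pair hξne]

end Scarf

/-! ### Counting doors and rooms -/

section Counting

variable {X I : Type*} [DecidableEq X] [Fintype I] [DecidableEq I]

/-- A set of `|I|` points that does not carry all colours has an even number of points whose removal
leaves exactly the colours other than `i₀`: none, or the two points that share a colour. -/
lemma even_card_filter_image_erase (c : X → I) (i₀ : I) {R : Finset X}
    (hcard : R.card = Fintype.card I) (hR : R.image c ≠ Finset.univ) :
    Even (R.filter fun x => (R.erase x).image c = Finset.univ.erase i₀).card := by
  rcases (R.filter fun x => (R.erase x).image c = Finset.univ.erase i₀).eq_empty_or_nonempty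
    with h | ⟨x, hx⟩
  · simp [h]
  obtain ⟨hxR, hx⟩ := Finset.mem_filter.1 hx
  have hinj : Set.InjOn c (R.erase x : Finset X) := by
    rw [← Finset.card_image_iff, hx, Finset.card_erase_of_mem (Finset.mem_univ _),
      Finset.card_erase_of_mem hxR, Finset.card_univ, hcard]
  have himg : R.image c = insert (c x) (Finset.univ.erase i₀) := by
    rw [← hx, ← Finset.image_insert, Finset.insert_erase hxR]
  have hcx : c x ≠ i₀ := by
    intro h
    rw [h, Finset.insert_erase (Finset.mem_univ _)] at himg
    exact hR himg
  have himg' : R.image c = Finset.univ.erase i₀ := by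
    rw [himg, Finset.insert_eq_of_mem (by simpa using hcx)]
  obtain ⟨x', hx'R, hx'c⟩ : ∃ x' ∈ R.erase x, c x' = c x := by
    rw [← Finset.mem_image, hx]; simpa using hcx
  have hx'x : x' ≠ x := Finset.ne_of_mem_erase hx'R
  have hset : (R.filter fun x => (R.erase x).image c = Finset.univ.erase i₀) = {x, x'} := by
    ext y
    simp only [Finset.mem_filter, Finset.mem_insert, Finset.mem_singleton]
    constructor
    · rintro ⟨hyR, hy⟩
      by_contra! hne
      have : c y ∈ (R.erase y).image c := by
        rw [hy, ← himg']; exact Finset.mem_image_of_mem _ hyR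
      obtain ⟨w, hw, hwy⟩ := Finset.mem_image.1 this
      have hyx : y ∈ R.erase x := Finset.mem_erase.2 ⟨hne.1, hyR⟩
      by_cases hwx : w = x
      · subst hwx
        exact hne.2 (hinj hyx hx'R (hwy.symm.trans hx'c.symm))
      · exact Finset.ne_of_mem_erase hw
          (hinj (Finset.mem_erase.2 ⟨hwx, Finset.mem_of_mem_erase hw⟩) hyx hwy)
    · rintro (rfl | rfl)
      · exact ⟨hxR, hx⟩
      · refine ⟨Finset.mem_of_mem_erase hx'R, ?_⟩
        rw [← himg']
        refine (Finset.image_subset_image (Finset.erase_subset _ _)).antisymm fun k hk => ?_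
        obtain ⟨w, hw, rfl⟩ := Finset.mem_image.1 hk
        by_cases hwy : w = y
        · subst hwy
          exact Finset.mem_image.2 ⟨x, Finset.mem_erase.2 ⟨hx'x.symm, hxR⟩, hx'c.symm⟩
        · exact Finset.mem_image_of_mem _ (Finset.mem_erase.2 ⟨hwy, hw⟩)
  rw [hset, Finset.card_pair hx'x.symm]
  exact even_two

variable [Fintype X]

lemma card_filter_superset_eq_ncard (P : Finset X → Prop) [DecidablePred P]
    (τ : Finset X) :
    (Finset.univ.filter fun R : Finset X => (P R ∧ R.card = τ.card + 1) ∧ τ ⊆ R).card =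
      {x | x ∉ τ ∧ P (insert x τ)}.ncard := by
  rw [← Set.ncard_coe_finset]
  refine (Set.ncard_congr (fun x _ => insert x τ) ?_ ?_ ?_).symm
  · rintro x ⟨hx, hP⟩
    simp [hP, Finset.card_insert_of_notMem hx]
  · rintro x y ⟨hx, -⟩ ⟨hy, -⟩ h
    exact (Finset.insert_inj hx).1 h
  · intro R hR
    simp only [Finset.coe_filter, Finset.mem_univ, true_and, Set.mem_ofPred_eq] at hR
    obtain ⟨⟨hP, hc⟩, hsub⟩ := hR
    obtain ⟨x, hx, rfl⟩ := Finset.exists_eq_insert_iff.2 ⟨hsub, hc.symm⟩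
    exact ⟨x, ⟨hx, hP⟩, rfl⟩

lemma card_filter_subset_eq_card_filter_erase (P : Finset X → Prop) [DecidablePred P]
    (R : Finset X) :
    (Finset.univ.filter fun τ : Finset X => (P τ ∧ τ.card + 1 = R.card) ∧ τ ⊆ R).card =
      (R.filter fun x => P (R.erase x)).card := by
  symm
  refine Finset.card_bij (fun x _ => R.erase x) ?_ ?_ ?_
  · intro x hx
    obtain ⟨hxR, hP⟩ := Finset.mem_filter.1 hx
    simp [hP, Finset.card_erase_add_one hxR, Finset.erase_subset]
  · intro x hx y hy h
    exact (Finset.erase_inj R (Finset.mem_filter.1 hx).1).1 h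
  · intro τ hτ
    simp only [Finset.mem_filter, Finset.mem_univ, true_and] at hτ
    obtain ⟨⟨hP, hc⟩, hsub⟩ := hτ
    obtain ⟨x, hx, rfl⟩ := Finset.exists_eq_insert_iff.2 ⟨hsub, hc⟩
    exact ⟨x, by simpa [hx] using hP, by simp [hx]⟩

end Counting

/-! ### Scarf's lemma -/

section Scarf

variable {T I α : Type*} [LinearOrder α] [Fintype T] [DecidableEq T] [Fintype I] [DecidableEq I]
  [Nonempty T]

/-- The boundary door, formed by all slack elements but one, has exactly one dominant extension: by
the largest proper element for the omitted order. -/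
lemma ncard_extensions_slack {e : I → T ⊕ I → α} (he : ∀ i, Function.Injective (e i))
    (hbot : ∀ i x, e i (Sum.inr i) ≤ e i x)
    (htop : ∀ i j t, j ≠ i → e i (Sum.inl t) < e i (Sum.inr j)) (i₀ : I) :
    {x | x ∉ (Finset.univ.erase i₀).image Sum.inr ∧
      IsDominant e (insert x ((Finset.univ.erase i₀).image Sum.inr))}.ncard = 1 := by
  have hlt : ∀ i t, e i (Sum.inr i) < e i (Sum.inl t) := fun i t =>
    lt_of_le_of_ne (hbot i _) fun h => by simpa using he i h
  obtain ⟨t₀, ht₀⟩ := Finite.exists_max fun t : T => e i₀ (Sum.inl t)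
  rw [Set.ncard_eq_one]
  refine ⟨Sum.inl t₀, Set.ext fun x => ?_⟩
  simp only [Set.mem_ofPred_eq, Set.mem_singleton_iff]
  constructor
  · rintro ⟨hx, hdom⟩
    have hkey : ∀ t, e i₀ (Sum.inl t) ≤ e i₀ x := by
      intro t
      obtain ⟨k, hk⟩ := hdom (Sum.inl t)
      by_cases hki : k = i₀
      · subst hki
        exact hk x (Finset.mem_insert_self _ _)
      · exact absurd (hk (Sum.inr k) (by simp [hki])) (not_le.2 (hlt k t))
    rcases x with t | i
    · exact he i₀ (le_antisymm (ht₀ t) (hkey t₀))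
    · have hi : i = i₀ := by by_contra h; simp [h] at hx
      subst hi
      exact absurd (hkey t₀) (not_le.2 (hlt _ _))
  · rintro rfl
    refine ⟨by simp, fun y => ?_⟩
    rcases y with t | k
    · refine ⟨i₀, fun x hx => ?_⟩
      rcases Finset.mem_insert.1 hx with rfl | hx
      · exact ht₀ t
      · obtain ⟨j, hj, rfl⟩ := Finset.mem_image.1 hx
        exact (htop i₀ j t (Finset.ne_of_mem_erase hj)).le
    · exact ⟨k, fun x _ => hbot k x⟩

/-- **Scarf's lemma.** Let a finite set `T` be enlarged by one slack element `inr i` for every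
`i : I`, and let every `i` come with a linear order for which `inr i` is the least element and the
other slack elements are above `T`. For every colouring of `T` by `I`, where `inr i` has colour `i`,
some dominant set of `|I|` elements carries all colours. -/
theorem exists_isDominant_image_eq_univ [Nonempty I] {e : I → T ⊕ I → α}
    (he : ∀ i, Function.Injective (e i))
    (hbot : ∀ i x, e i (Sum.inr i) ≤ e i x)
    (htop : ∀ i j t, j ≠ i → e i (Sum.inl t) < e i (Sum.inr j)) (c : T → I) :
    ∃ R : Finset (T ⊕ I), R.card = Fintype.card I ∧ IsDominant e R ∧
      R.image (Sum.elim c id) = Finset.univ := by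
  classical
  by_contra! hno
  obtain ⟨i₀⟩ := ‹Nonempty I›
  set c' : T ⊕ I → I := Sum.elim c id with hc'
  set τ₀ : Finset (T ⊕ I) := (Finset.univ.erase i₀).image Sum.inr with hτ₀
  have hn : (Finset.univ.erase i₀ : Finset I).card + 1 = Fintype.card I := by
    rw [Finset.card_erase_add_one (Finset.mem_univ _), Finset.card_univ]
  have hτ₀card : τ₀.card + 1 = Fintype.card I := by
    rw [hτ₀, Finset.card_image_of_injective _ Sum.inr_injective, hn]
  have hτ₀one := ncard_extensions_slack he hbot htop i₀
  have hτ₀dom : IsDominant e τ₀ := by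
    obtain ⟨x, hx⟩ := Set.ncard_eq_one.1 hτ₀one
    have : x ∈ ({x} : Set (T ⊕ I)) := rfl
    rw [← hx] at this
    exact this.2.mono (Finset.subset_insert _ _)
  let doors : Finset (Finset (T ⊕ I)) := Finset.univ.filter fun τ =>
    (IsDominant e τ ∧ τ.image c' = Finset.univ.erase i₀) ∧ τ.card + 1 = Fintype.card I
  let rooms : Finset (Finset (T ⊕ I)) := Finset.univ.filter fun R =>
    IsDominant e R ∧ R.card = Fintype.card I
  have hcount := Finset.sum_card_bipartiteAbove_eq_sum_card_bipartiteBelow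
    (s := doors) (t := rooms) (fun τ R => τ ⊆ R)
  have habove : ∀ τ ∈ doors, (rooms.bipartiteAbove (fun τ R => τ ⊆ R) τ).card =
      {x | x ∉ τ ∧ IsDominant e (insert x τ)}.ncard := by
    intro τ hτ
    rw [← card_filter_superset_eq_ncard, (Finset.mem_filter.1 hτ).2.2, Finset.bipartiteAbove,
      Finset.filter_filter]
  have hbelow : ∀ R ∈ rooms, Even (doors.bipartiteBelow (fun τ R => τ ⊆ R) R).card := by
    intro R hR
    obtain ⟨-, hdom, hcard⟩ := Finset.mem_filter.1 hR
    rw [Finset.bipartiteBelow, Finset.filter_filter, ← hcard,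
      card_filter_subset_eq_card_filter_erase
        (fun τ => IsDominant e τ ∧ τ.image c' = Finset.univ.erase i₀)]
    have : ∀ x, IsDominant e (R.erase x) := fun x => hdom.mono (Finset.erase_subset _ _)
    simp only [this, true_and]
    exact even_card_filter_image_erase c' i₀ hcard (hno R hcard hdom)
  have hτ₀mem : τ₀ ∈ doors := by
    refine Finset.mem_filter.2 ⟨Finset.mem_univ _, ⟨hτ₀dom, ?_⟩, hτ₀card⟩
    rw [hτ₀, Finset.image_image]
    exact (Finset.image_congr fun _ _ => rfl).trans Finset.image_id
  have hinterior : ∀ τ ∈ doors.erase τ₀,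
      (rooms.bipartiteAbove (fun τ R => τ ⊆ R) τ).card = 2 := by
    intro τ hτ
    obtain ⟨hτne, hτ⟩ := Finset.mem_erase.1 hτ
    rw [habove τ hτ]
    obtain ⟨-, ⟨hdom, hcol⟩, hcard⟩ := Finset.mem_filter.1 hτ
    obtain ⟨t, ht⟩ : ∃ t, Sum.inl t ∈ τ := by
      by_contra! h
      apply hτne
      rw [hτ₀, ← hcol, Finset.image_image]
      refine (Finset.image_id.symm.trans (Finset.image_congr fun x hx => ?_))
      rcases x with t | i
      · exact absurd hx (h t)
      · rfl
    exact hdom.card_extensions he ⟨_, ht⟩ hcard fun i =>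
      ⟨Sum.inr i, fun k hk => ⟨_, ht, htop k i t hk.symm⟩⟩
  rw [← Finset.add_sum_erase _ _ hτ₀mem, habove _ hτ₀mem, hτ₀one,
    Finset.sum_congr rfl hinterior] at hcount
  have h2 : Even (∑ R ∈ rooms, (doors.bipartiteBelow (fun τ R => τ ⊆ R) R).card) :=
    Finset.even_sum _ hbelow
  rw [← hcount, Finset.sum_const, smul_eq_mul] at h2
  exact absurd h2 (by simp [Nat.even_add_one, add_comm 1])

end Scarf

/-! ### Brouwer's fixed point theorem on the standard simplex -/

section Brouwer

variable {I : Type*} [Fintype I] [Nonempty I]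

/-- Scarf's lemma for the points of the simplex with coordinates in `m⁻¹ℤ`, scaled by `m`: for every
colouring, some lattice point has, for each colour `i`, a nearby point of colour `i`, unless its
`i`-th coordinate is itself small. -/
theorem exists_lattice_point_close_to_colours (m : ℕ) (c : (I → ℕ) → I) :
    ∃ x : I → ℕ, ∑ i, x i = m ∧ ∀ i, x i ≤ Fintype.card I ∨
      ∃ z : I → ℕ, ∑ i, z i = m ∧ c z = i ∧
        ∀ j, z j ≤ x j + Fintype.card I ∧ x j ≤ z j + Fintype.card I := by
  classical
  let T := {t : I → ℕ // t ∈ Finset.piAntidiag Finset.univ m}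
  let : Fintype T := inferInstanceAs
    (Fintype {t : I → ℕ // t ∈ Finset.piAntidiag Finset.univ m})
  have hT : ∀ t : T, ∑ i, t.1 i = m := fun t => (Finset.mem_piAntidiag.1 t.2).1
  have mkT : ∀ t : I → ℕ, ∑ i, t i = m → t ∈ Finset.piAntidiag Finset.univ m := fun t ht =>
    Finset.mem_piAntidiag.2 ⟨ht, fun i _ => Finset.mem_univ i⟩
  obtain ⟨i₀⟩ := ‹Nonempty I›
  have : Nonempty I := ⟨i₀⟩
  have : Nonempty T := ⟨⟨Pi.single i₀ m, mkT _ (by simp)⟩⟩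
  -- The orders compare the `i`-th coordinates and break ties by a fixed numbering; the slack element
  -- of `i` has level `0`, below the levels `t i + 1`, and the others have level `m + 2`, above them.
  let lvl : I → T ⊕ I → ℕ := fun i =>
    Sum.elim (fun t => t.1 i + 1) fun j => if j = i then 0 else m + 2
  let e : I → T ⊕ I → ℕ ×ₗ Fin (Fintype.card (T ⊕ I)) := fun i x =>
    toLex (lvl i x, Fintype.equivFin (T ⊕ I) x)
  have he : ∀ i, Function.Injective (e i) := fun i x y h => by
    have := congrArg (fun p => (ofLex p).2) h
    exact (Fintype.equivFin (T ⊕ I)).injective this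
  have hlt : ∀ i x y, lvl i x < lvl i y → e i x < e i y := fun i x y h =>
    Prod.Lex.toLex_lt_toLex.2 (Or.inl h)
  have hle : ∀ i x y, e i x ≤ e i y → lvl i x ≤ lvl i y := fun i x y h => by
    by_contra! h'
    exact absurd h (not_le.2 (hlt _ _ _ h'))
  have hbot : ∀ i x, e i (Sum.inr i) ≤ e i x := by
    intro i x
    by_cases hx : x = Sum.inr i
    · rw [hx]
    · refine (hlt _ _ _ ?_).le
      rcases x with t | j
      · simp [lvl]
      · have : j ≠ i := fun h => hx (by rw [h])
        simp [lvl, this]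
  have htop : ∀ i j t, j ≠ i → e i (Sum.inl t) < e i (Sum.inr j) := by
    intro i j t hj
    apply hlt
    have : t.1 i ≤ m := by
      refine le_of_le_of_eq ?_ (hT t)
      exact Finset.single_le_sum (f := t.1) (fun _ _ => Nat.zero_le _) (Finset.mem_univ i)
    simp only [lvl, Sum.elim_inl, Sum.elim_inr, hj, if_false]
    omega
  obtain ⟨R, hcard, hdom, hcol⟩ :=
    exists_isDominant_image_eq_univ he hbot htop fun t : T => c t.1
  -- `C` is the set of the orders whose slack element is missing from `R`.
  set C : Finset I := Finset.univ.filter fun i => Sum.inr i ∉ R with hC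
  obtain ⟨t₀, ht₀⟩ : ∃ t : T, Sum.inl t ∈ R := by
    by_contra! h
    have hsub : R ⊆ Finset.univ.image Sum.inr := by
      intro x hx
      rcases x with t | j
      · exact absurd hx (h t)
      · simp
    have hR := Finset.eq_of_subset_of_card_le hsub (by
      rw [hcard]; exact Finset.card_image_le)
    obtain ⟨k, hk⟩ := hdom (Sum.inl (Classical.arbitrary T))
    have := hle _ _ _ (hk (Sum.inr k) (by rw [hR]; simp))
    simp [lvl] at this
  have hCne : C.Nonempty := by
    by_contra h
    rw [Finset.not_nonempty_iff_eq_empty] at h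
    have hall : ∀ i, Sum.inr i ∈ R := fun i => by
      by_contra hi
      have : i ∈ C := by simp [hC, hi]
      simp [h] at this
    obtain ⟨k, hk⟩ := hdom (Sum.inl t₀)
    have := hle _ _ _ (hk _ (hall k))
    simp [lvl] at this
  have hmin : ∀ i, ∃ t : T, Sum.inl t ∈ R ∧ ∀ t' : T, Sum.inl t' ∈ R → t.1 i ≤ t'.1 i := by
    intro i
    obtain ⟨t, ht, h⟩ := (Finset.univ.filter fun t : T => Sum.inl t ∈ R).exists_min_image
      (fun t => t.1 i) ⟨t₀, by simpa using ht₀⟩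
    exact ⟨t, by simpa using ht, fun t' ht' => h t' (by simpa using ht')⟩
  choose μ hμR hμ using hmin
  -- If the sum were at most `m`, it could be topped up to a lattice point that violates dominance.
  have hsum : m < ∑ i ∈ C, ((μ i).1 i + 1) := by
    by_contra! hsum
    obtain ⟨j, hj⟩ := hCne
    let y : I → ℕ := fun i => (if i ∈ C then (μ i).1 i + 1 else 0) +
      (Pi.single j (m - ∑ i ∈ C, ((μ i).1 i + 1)) : I → ℕ) i
    have hy : ∑ i, y i = m := by
      have h1 : ∑ i, (if i ∈ C then (μ i).1 i + 1 else 0) = ∑ i ∈ C, ((μ i).1 i + 1) := by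
        rw [Finset.sum_ite_mem, Finset.univ_inter]
      refine Finset.sum_add_distrib.trans ?_
      rw [h1, Finset.sum_pi_single' j, if_pos (Finset.mem_univ j)]
      exact Nat.add_sub_cancel' hsum
    obtain ⟨k, hk⟩ := hdom (Sum.inl ⟨y, mkT y hy⟩)
    by_cases hkC : k ∈ C
    · have := hle _ _ _ (hk _ (hμR k))
      simp only [lvl, Sum.elim_inl, y, hkC, if_true] at this
      omega
    · have hkR : Sum.inr k ∈ R := by simpa [hC] using hkC
      have := hle _ _ _ (hk _ hkR)
      simp [lvl] at this
  -- On `R` the coordinates lie above the minima, whose sum exceeds `m - |I|`.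
  have hclose : ∀ t : T, Sum.inl t ∈ R → ∀ i,
      t.1 i ≤ (if i ∈ C then (μ i).1 i else 0) + Fintype.card I := by
    intro t ht i
    have hlow : ∀ j, (if j ∈ C then (μ j).1 j else 0) ≤ t.1 j := by
      intro j
      split_ifs
      · exact hμ j t ht
      · exact Nat.zero_le _
    have h1 : ∑ j, (t.1 j - if j ∈ C then (μ j).1 j else 0) +
        ∑ j, (if j ∈ C then (μ j).1 j else 0) = m := by
      rw [← Finset.sum_add_distrib]
      refine Eq.trans ?_ (hT t)
      exact Finset.sum_congr rfl fun j _ => Nat.sub_add_cancel (hlow j)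
    have h2 := Finset.single_le_sum (f := fun j => t.1 j - if j ∈ C then (μ j).1 j else 0)
      (fun _ _ => Nat.zero_le _) (Finset.mem_univ i)
    have h3 : ∑ j, (if j ∈ C then (μ j).1 j else 0) = ∑ j ∈ C, (μ j).1 j := by simp
    have h4 : C.card ≤ Fintype.card I := Finset.card_le_univ C
    rw [Finset.sum_add_distrib, Finset.sum_const, smul_eq_mul, mul_one] at hsum
    have h5 := hlow i
    omega
  refine ⟨t₀.1, hT t₀, fun i => ?_⟩
  by_cases hi : i ∈ C
  · right
    have : i ∈ R.image (Sum.elim (fun t : T => c t.1) id) := by rw [hcol]; simp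
    obtain ⟨z, hz, hzi⟩ := Finset.mem_image.1 this
    rcases z with z | j
    · refine ⟨z.1, hT z, hzi, fun j => ?_⟩
      have h1 := hclose z hz j
      have h2 := hclose t₀ ht₀ j
      have h3 := hμ j z hz
      have h4 := hμ j t₀ ht₀
      split_ifs at h1 h2 <;> omega
    · have hji : j = i := hzi
      subst hji
      exact absurd hz (by simpa [hC] using hi)
  · left
    simpa [hi] using hclose t₀ ht₀ i

lemma eq_of_le_of_mem_stdSimplex {ι : Type*} [Fintype ι] {x y : ι → ℝ} (hx : x ∈ stdSimplex ℝ ι)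
    (hy : y ∈ stdSimplex ℝ ι) (h : ∀ i, x i ≤ y i) : x = y := by
  funext i
  exact (Finset.sum_eq_sum_iff_of_le fun i _ => h i).1 (hx.2.trans hy.2.symm) i (Finset.mem_univ i)

/-- The lattice points `z / m` are coloured by a coordinate that `f` does not decrease. At the lattice
point found by Scarf's lemma, a coordinate either has a point of its colour nearby, and uniform
continuity bounds its decrease, or is itself at most `ε`. -/
lemma exists_sub_le_of_mapsTo_stdSimplex {f : (I → ℝ) → I → ℝ}
    (hf : ContinuousOn f (stdSimplex ℝ I))
    (hmaps : Set.MapsTo f (stdSimplex ℝ I) (stdSimplex ℝ I)) {ε : ℝ} (hε : 0 < ε) :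
    ∃ x ∈ stdSimplex ℝ I, ∀ i, x i - f x i ≤ ε := by
  obtain ⟨δ, hδ, hunif⟩ := Metric.uniformContinuousOn_iff.1
    ((isCompact_stdSimplex ℝ I).uniformContinuousOn_of_continuous hf) (ε / 2) (by positivity)
  obtain ⟨m, hm⟩ := exists_nat_gt ((Fintype.card I : ℝ) / min δ (ε / 2))
  have hmin : 0 < min δ (ε / 2) := by positivity
  have hm0 : (0 : ℝ) < m := lt_of_le_of_lt (by positivity) hm
  have hnm : (Fintype.card I : ℝ) / m < min δ (ε / 2) := by
    rw [div_lt_iff₀ hmin] at hm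
    rw [div_lt_iff₀ hm0]
    linarith
  have hnδ := hnm.trans_le (min_le_left _ _)
  have hnε := hnm.trans_le (min_le_right _ _)
  let q : (I → ℕ) → I → ℝ := fun z i => z i / m
  have hq : ∀ z : I → ℕ, ∑ i, z i = m → q z ∈ stdSimplex ℝ I := by
    intro z hz
    refine ⟨fun i => by positivity, ?_⟩
    simp only [q]
    rw [← Finset.sum_div, ← Nat.cast_sum, hz, div_self hm0.ne']
  have hcol : ∀ z : I → ℕ, ∃ i, ∑ i, z i = m → q z i ≤ f (q z) i := by
    intro z
    by_cases hz : ∑ i, z i = m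
    · obtain ⟨i, -, hi⟩ := Finset.exists_le_of_sum_le (s := Finset.univ) (f := q z) (g := f (q z))
        Finset.univ_nonempty ((hq z hz).2.trans (hmaps (hq z hz)).2.symm).le
      exact ⟨i, fun _ => hi⟩
    · exact ⟨Classical.arbitrary I, fun h => absurd h hz⟩
  choose c hc using hcol
  obtain ⟨x, hx, hxc⟩ := exists_lattice_point_close_to_colours m c
  refine ⟨q x, hq x hx, fun i => ?_⟩
  rcases hxc i with h | ⟨z, hz, rfl, hzx⟩
  · have h1 : q x i ≤ (Fintype.card I : ℝ) / m := by
      simp only [q]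
      gcongr
    have h2 := (hmaps (hq x hx)).1 i
    linarith
  · have habs : ∀ j, |q x j - q z j| ≤ (Fintype.card I : ℝ) / m := by
      intro j
      have h1 : (z j : ℝ) ≤ x j + Fintype.card I := by exact_mod_cast (hzx j).1
      have h2 : (x j : ℝ) ≤ z j + Fintype.card I := by exact_mod_cast (hzx j).2
      simp only [q]
      rw [← sub_div, abs_div, abs_of_pos hm0]
      gcongr
      rw [abs_le]
      constructor <;> linarith
    have hdist : dist (q x) (q z) < δ :=
      ((dist_pi_le_iff (by positivity)).2 habs).trans_lt hnδ
    have hfd := (dist_le_pi_dist (f (q x)) (f (q z)) (c z)).trans_lt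
      (hunif _ (hq x hx) _ (hq z hz) hdist)
    rw [Real.dist_eq, abs_lt] at hfd
    have h3 := abs_le.1 (habs (c z))
    have h4 := hc z hz
    linarith [hfd.1, h3.2]

/-- **Brouwer's fixed point theorem** for the standard simplex. -/
theorem exists_fixedPoint_of_mapsTo_stdSimplex {f : (I → ℝ) → I → ℝ}
    (hf : ContinuousOn f (stdSimplex ℝ I))
    (hmaps : Set.MapsTo f (stdSimplex ℝ I) (stdSimplex ℝ I)) :
    ∃ x ∈ stdSimplex ℝ I, f x = x := by
  classical
  let g : (I → ℝ) → ℝ := fun x => ∑ i, max (x i - f x i) 0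
  have hg : ContinuousOn g (stdSimplex ℝ I) := by
    refine continuousOn_finsetSum _ fun i _ => ContinuousOn.sup ?_ continuousOn_const
    exact (continuous_apply i).continuousOn.sub ((continuous_apply i).comp_continuousOn hf)
  obtain ⟨x, hx, hxmin⟩ := (isCompact_stdSimplex ℝ I).exists_isMinOn
    ⟨_, single_mem_stdSimplex ℝ (Classical.arbitrary I)⟩ hg
  have hgx : g x ≤ 0 := by
    refine le_of_forall_pos_le_add fun ε hε => ?_
    have hn : (0 : ℝ) < Fintype.card I := by exact_mod_cast Fintype.card_pos
    obtain ⟨y, hy, hyε⟩ := exists_sub_le_of_mapsTo_stdSimplex hf hmaps (div_pos hε hn)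
    calc g x ≤ g y := hxmin hy
      _ ≤ ∑ _i : I, ε / Fintype.card I := Finset.sum_le_sum fun i _ =>
          max_le (hyε i) (div_pos hε hn).le
      _ = 0 + ε := by
          rw [Finset.sum_const, Finset.card_univ, nsmul_eq_mul, mul_div_cancel₀ _ hn.ne', zero_add]
  refine ⟨x, hx, (eq_of_le_of_mem_stdSimplex hx (hmaps hx) fun i => ?_).symm⟩
  have h1 := Finset.single_le_sum (f := fun i => max (x i - f x i) 0)
    (fun i _ => le_max_right _ _) (Finset.mem_univ i)
  have h2 : x i - f x i ≤ 0 := (le_max_left _ _).trans (h1.trans hgx)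
  linarith

end Brouwer

/-! ### The logit map and the Q-learning dynamics -/

namespace FiniteGame

section Logit

variable {A : Type*} [Fintype A] [Nonempty A]

lemma logitResponse_pos (t : ℝ) (v : A → ℝ) (i : A) : 0 < logitResponse t v i := by
  unfold logitResponse
  positivity

lemma logitResponse_mem_stdSimplex (t : ℝ) (v : A → ℝ) :
    logitResponse t v ∈ stdSimplex ℝ A := by
  refine ⟨fun i => (logitResponse_pos t v i).le, ?_⟩
  have h : 0 < ∑ j, Real.exp (v j / t) := by positivity
  simp only [logitResponse]
  rw [← Finset.sum_div, div_self h.ne']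

lemma continuous_logitResponse (t : ℝ) : Continuous (logitResponse t : (A → ℝ) → A → ℝ) := by
  refine continuous_pi fun i => ?_
  simp only [logitResponse]
  refine Continuous.div (by fun_prop) (by fun_prop) fun v => ?_
  have h : 0 < ∑ j, Real.exp (v j / t) := by positivity
  exact h.ne'

lemma log_logitResponse {t : ℝ} (ht : t ≠ 0) (v : A → ℝ) (i : A) :
    t * Real.log (logitResponse t v i) = v i - t * Real.log (∑ j, Real.exp (v j / t)) := by
  have h : 0 < ∑ j, Real.exp (v j / t) := by positivity
  simp only [logitResponse]
  rw [Real.log_div (Real.exp_ne_zero _) h.ne', Real.log_exp]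
  field_simp

/-- A positive probability vector `p` is the logit response to `v` exactly if `v i - t log (p i)`
does not depend on `i`. -/
lemma eq_logitResponse_iff {t : ℝ} (ht : t ≠ 0) {v p : A → ℝ} (hp : p ∈ stdSimplex ℝ A)
    (hpos : ∀ i, 0 < p i) :
    p = logitResponse t v ↔ ∃ a, ∀ i, v i - t * Real.log (p i) = a := by
  constructor
  · rintro rfl
    exact ⟨t * Real.log (∑ j, Real.exp (v j / t)), fun i => by rw [log_logitResponse ht]; ring⟩
  · rintro ⟨a, ha⟩
    have hexp : ∀ i, Real.exp (v i / t) = Real.exp (a / t) * p i := by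
      intro i
      have hv : v i / t = a / t + Real.log (p i) := by
        rw [← ha i]
        field_simp
        ring
      rw [hv, Real.exp_add, Real.exp_log (hpos i)]
    funext i
    have hE := Real.exp_ne_zero (a / t)
    simp only [logitResponse, hexp]
    rw [← Finset.mul_sum, hp.2, mul_one, mul_div_cancel_left₀ _ hE]

end Logit

variable {V : Type*} [Fintype V] [DecidableEq V] {S : V → Type*}
  [∀ k, Fintype (S k)] [∀ k, DecidableEq (S k)]

lemma continuous_reward (Γ : FiniteGame V S) (k : V) :
    Continuous fun x : ∀ k, S k → ℝ => Γ.reward x k := by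
  refine continuous_pi fun i => ?_
  have hu : Continuous fun x : ∀ k, S k → ℝ =>
      Function.update x k (Pi.single i 1 : S k → ℝ) := continuous_id.update k continuous_const
  unfold reward expectedPayoff
  refine continuous_finsetSum _ fun s _ => Continuous.mul ?_ continuous_const
  exact continuous_finsetProd _ fun j _ =>
    (continuous_apply (s j)).comp ((continuous_apply j).comp hu)

/-- In a positive mixed profile, the field is `x_{ki}` times the deviation of
`r_{ki} - T_k log x_{ki}` from its mean over `i`, so it vanishes exactly if this quantity does not
depend on `i`. -/
lemma forall_qLearningField_eq_zero_iff (Γ : FiniteGame V S) (T : V → ℝ) {p : ∀ k, S k → ℝ}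
    (hp : p ∈ mixedProfiles V S) (hpos : ∀ k i, 0 < p k i) (k : V) :
    (∀ i, Γ.qLearningField T p k i = 0) ↔
      ∃ a, ∀ i, Γ.reward p k i - T k * Real.log (p k i) = a := by
  have hfield : ∀ i, Γ.qLearningField T p k i = p k i *
      ((Γ.reward p k i - T k * Real.log (p k i)) -
        ∑ j, p k j * (Γ.reward p k j - T k * Real.log (p k j))) := by
    intro i
    have h : ∑ j, p k j * (Γ.reward p k j - T k * Real.log (p k j)) =
        ∑ j, p k j * Γ.reward p k j - T k * ∑ j, p k j * Real.log (p k j) := by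
      rw [Finset.mul_sum, ← Finset.sum_sub_distrib]
      exact Finset.sum_congr rfl fun j _ => by ring
    rw [h, qLearningField]
    ring
  constructor
  · intro h
    refine ⟨∑ j, p k j * (Γ.reward p k j - T k * Real.log (p k j)), fun i => ?_⟩
    have h1 := h i
    rw [hfield, mul_eq_zero] at h1
    exact sub_eq_zero.1 (h1.resolve_left (hpos k i).ne')
  · rintro ⟨a, ha⟩ i
    rw [hfield]
    simp only [ha]
    rw [← Finset.sum_mul, (hp k).2, one_mul, sub_self, mul_zero]

variable [∀ k, Nonempty (S k)]

/-- The logit system already forces every `p k` to be a positive probability vector. -/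
lemma isInteriorFixedPoint_iff_eq_logitResponse (Γ : FiniteGame V S) {T : V → ℝ}
    (hT : ∀ k, 0 < T k) (p : ∀ k, S k → ℝ) :
    Γ.IsInteriorFixedPoint T p ↔ ∀ k, p k = logitResponse (T k) (Γ.reward p k) := by
  constructor
  · rintro ⟨hp, hpos, hfix⟩ k
    exact (eq_logitResponse_iff (hT k).ne' (hp k) (hpos k)).2
      ((Γ.forall_qLearningField_eq_zero_iff T hp hpos k).1 (hfix k))
  · intro h
    have hp : p ∈ mixedProfiles V S := fun k => by
      rw [h k]
      exact logitResponse_mem_stdSimplex _ _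
    have hpos : ∀ k i, 0 < p k i := fun k i => by
      rw [h k]
      exact logitResponse_pos _ _ _
    exact ⟨hp, hpos, fun k => (Γ.forall_qLearningField_eq_zero_iff T hp hpos k).2
      ((eq_logitResponse_iff (hT k).ne' (hp k) (hpos k)).1 (h k))⟩

/-- The joint logit response map has a fixed point. Divided by the number of players, the
concatenation of a profile of probability vectors is a point of the simplex on `Σ k, S k`, and the
logit map, defined on all real vectors, becomes a self-map of this one simplex. -/
lemma exists_eq_logitResponse (Γ : FiniteGame V S) (T : V → ℝ) :
    ∃ p : ∀ k, S k → ℝ, ∀ k, p k = logitResponse (T k) (Γ.reward p k) := by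
  rcases isEmpty_or_nonempty V with hV | hV
  · exact ⟨fun k => isEmptyElim k, fun k => isEmptyElim k⟩
  have hN : (Fintype.card V : ℝ) ≠ 0 := by exact_mod_cast Fintype.card_ne_zero
  let unscale : ((Σ k, S k) → ℝ) → ∀ k, S k → ℝ := fun y k i => Fintype.card V * y ⟨k, i⟩
  let f : ((Σ k, S k) → ℝ) → (Σ k, S k) → ℝ := fun y a =>
    logitResponse (T a.1) (Γ.reward (unscale y) a.1) a.2 / Fintype.card V
  have hunscale : Continuous unscale := by fun_prop
  have hf : Continuous f := continuous_pi fun a => ((continuous_apply a.2).comp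
    ((continuous_logitResponse (T a.1)).comp
      ((Γ.continuous_reward a.1).comp hunscale))).div_const _
  have hmaps : ∀ y, f y ∈ stdSimplex ℝ (Σ k, S k) := by
    intro y
    refine ⟨fun a => div_nonneg (logitResponse_pos _ _ _).le (Nat.cast_nonneg _), ?_⟩
    simp only [f]
    rw [← Finset.sum_div, Fintype.sum_sigma]
    simp only [(logitResponse_mem_stdSimplex _ _).2]
    simp [hN]
  have : Nonempty (Σ k, S k) := hV.elim fun k => ⟨⟨k, Classical.arbitrary _⟩⟩
  obtain ⟨y, -, hy⟩ := exists_fixedPoint_of_mapsTo_stdSimplex hf.continuousOn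
    fun y _ => hmaps y
  refine ⟨unscale y, fun k => funext fun i => ?_⟩
  have h : f y ⟨k, i⟩ = y ⟨k, i⟩ := congrFun hy _
  simp only [unscale]
  rw [← h]
  exact mul_div_cancel₀ _ hN

end FiniteGame

/-! ### Interior fixed points and quantal response equilibria -/

theorem mainTheorem2 {V : Type*} [Fintype V] [DecidableEq V] {S : V → Type*}
    [∀ k, Fintype (S k)] [∀ k, DecidableEq (S k)] [∀ k, Nonempty (S k)]
    (Γ : FiniteGame V S) (T : V → ℝ) (hT : ∀ k, 0 < T k) :
    (∀ p : ∀ k, S k → ℝ, Γ.IsInteriorFixedPoint T p ↔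
      ∀ k i, p k i = Real.exp (Γ.reward p k i / T k) /
        ∑ j, Real.exp (Γ.reward p k j / T k)) ∧
    (∀ p : ∀ k, S k → ℝ, Γ.IsInteriorFixedPoint T p ↔ Γ.IsQRE T p) ∧
    (∃ p : ∀ k, S k → ℝ, Γ.IsInteriorFixedPoint T p) ∧
    (∀ p : ∀ k, S k → ℝ, Γ.IsInteriorFixedPoint T p →
      ∀ k, ∀ x ∈ stdSimplex ℝ (S k),
        ∑ i, (x i - p k i) * (Γ.reward p k i - T k * Real.log (p k i)) = 0) := by
  have key := Γ.isInteriorFixedPoint_iff_eq_logitResponse hT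
  refine ⟨fun p => ?_, fun p => ?_, ?_, ?_⟩
  · rw [key p]
    exact forall_congr' fun k => funext_iff
  · exact ⟨fun h => ⟨h.1, (key p).1 h⟩, fun h => (key p).2 h.2⟩
  · obtain ⟨p, hp⟩ := Γ.exists_eq_logitResponse T
    exact ⟨p, (key p).2 hp⟩
  · rintro p ⟨hp, hpos, hfix⟩ k x hx
    obtain ⟨a, ha⟩ := (Γ.forall_qLearningField_eq_zero_iff T hp hpos k).1 (hfix k)
    simp only [ha]
    rw [← Finset.sum_mul, Finset.sum_sub_distrib, hx.2, (hp k).2, sub_self, zero_mul]
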